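/- Setting. Logarithms are to base 2. Let $\mathcal X,\mathcal Y$ be finite alphabets with $|\mathcal X|,|\mathcal Y|\ge 2$. A general source $(\mathbf X,\mathbf Y)$ is a sequence of arbitrary joint distributions $P_{X^nY^n}$ on $\mathcal X^n\times\mathcal Y^n$. It is smooth if there is $0<q<1$, independent of $n$, with $P_{X^nY^n}(\mathbf x,\hat{\mathbf y})\ge q\,P_{X^nY^n}(\mathbf x,\mathbf y)$ whenever $\mathbf y,\hat{\mathbf y}$ have Hamming distance 1, and likewise with the roles of the two components exchanged. A variable-length code ($\mathsf{vl}$) for $f_n:\mathcal X^n\times\mathcal Y^n\to\mathcal Z_n$ consists of encoders $\varphi^{(1)}_n:\mathcal X^n\to\{0,1\}^*$, $\varphi^{(2)}_n:\mathcal Y^n\to\{0,1\}^*$, each with a prefix-free set of codewords, and a decoder $\psi_n$ mapping pairs of codewords to $\mathcal Z_n$; it is a fixed-length code ($\mathsf{fl}$) if all codewords of each encoder have the same length. For $**\in\{\mathsf{fl},\mathsf{vl}\}$, $\mathcal R^{**}(\mathbf X,\mathbf Y|\mathbf f)$ is the set of $(R_1,R_2)$ for which there are such codes with $\Pr\{\psi_n(\varphi^{(1)}_n(X^n),\varphi^{(2)}_n(Y^n))\ne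 f_n(X^n,Y^n)\}\to0$, $\limsup_n\frac1n\mathbb E|\varphi^{(1)}_n(X^n)|\le R_1$ and $\limsup_n\frac1n\mathbb E|\varphi^{(2)}_n(Y^n)|\le R_2$. The Slepian-Wolf region $\mathcal R^{**}_{\mathrm{SW}}(\mathbf X,\mathbf Y)$ is this region for $f_n(\mathbf x,\mathbf y)=(\mathbf x,\mathbf y)$; $R^{**}_{\mathrm{SW}}(\mathbf X|\mathbf Y)=\inf\{R_1:(R_1,\log|\mathcal Y|)\in\mathcal R^{**}_{\mathrm{SW}}(\mathbf X,\mathbf Y)\}$ and $R^{**}_{\mathrm{SW}}(\mathbf Y|\mathbf X)=\inf\{R_2:(\log|\mathcal X|,R_2)\in\mathcal R^{**}_{\mathrm{SW}}(\mathbf X,\mathbf Y)\}$. A function $f_n$ is sensitive conditioned on $\mathcal Y^n$ if, whenever $f_n(\mathbf x,\mathbf y)=f_n(\hat{\mathbf x},\mathbf y)$ and $x_i\ne\hat x_i$, there is $\hat{\mathbf y}$ differing from $\mathbf y$ exactly in coordinate $i$ with $f_n(\mathbf x,\hat{\mathbf y})\ne f_n(\hat{\mathbf x},\hat{\mathbf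 y})$; sensitivity conditioned on $\mathcal X^n$ is defined symmetrically. Let $\mathrm{EQ}(z|f_n)$ be the largest $J$ for which there are pairs $(\mathbf x_1,\mathbf y_1),\dots,(\mathbf x_J,\mathbf y_J)$ with pairwise distinct $\mathbf x_j$, pairwise distinct $\mathbf y_j$ and $f_n(\mathbf x_j,\mathbf y_j)=z$ for all $j$. A sequence $\mathbf f=\{f_n\}$ is $r$-totally sensitive if $\limsup_n\frac1n\log\max_z\mathrm{EQ}(z|f_n)\le r$ and every $f_n$ is sensitive conditioned on both $\mathcal X^n$ and $\mathcal Y^n$. Theorem. Let $\bar r=\min\{\log|\mathcal X|,\log|\mathcal Y|\}$, $\delta>0$, $0\le r\le\bar r$ and $\rho=r/\bar r$. There exist an $r$-totally sensitive $\mathbf f$ and a smooth source $(\mathbf X,\mathbf Y)$ such that, for both $**=\mathsf{fl}$ and $**=\mathsf{vl}$, $$\mathcal R^{**}(\mathbf X,\mathbf Y|\mathbf f)\supseteq\{(R_1,R_2):R_1\ge\delta+(1-\rho)\log|\mathcal X|,\ R_2\ge\delta+(1-\rho)\log|\mathcal Y|\}$$ and $$\mathcal R^{**}_{\mathrm{SW}}(\mathbf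 X,\mathbf Y)\subseteq\{(R_1,R_2):R_1\ge(1-\rho)\log|\mathcal X|,\ R_2\ge(1-\rho)\log|\mathcal Y|,\ R_1+R_2\ge r-\delta+(1-\rho)\log|\mathcal X||\mathcal Y|\}.$$ Here $\mathbf f$ can be taken of the following form: for some prime $p$ and some embeddings of $\mathcal X$ and $\mathcal Y$ into $\mathrm{GF}(p)$, the $i$-th component of $f_n(\mathbf x,\mathbf y)$ is the sum $x_i\oplus y_i$ in $\mathrm{GF}(p)$ for $i\le\lfloor n\rho\rfloor$ and the pair $(x_i,y_i)$ for $i>\lfloor n\rho\rfloor$. Consequently, for the same $\mathbf f$ and $(\mathbf X,\mathbf Y)$, the outer bound $$\mathcal O^{**}=\{(R_1,R_2):\exists\lambda\in[0,1],\ (R_1+\lambda r,R_2+(1-\lambda)r)\in\mathcal R^{**}_{\mathrm{SW}}(\mathbf X,\mathbf Y),\ R_1\ge R^{**}_{\mathrm{SW}}(\mathbf X|\mathbf Y),\ R_2\ge R^{**}_{\mathrm{SW}}(\mathbf Y|\mathbf X)\}$$ is tight up to $\delta$: if $(R_1,R_2)\in\mathcal O^{**}$ then $(R_1+\delta,R_2+\delta)\in\mathcal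 R^{**}(\mathbf X,\mathbf Y|\mathbf f)$. -/

import Mathlib

open Filter

noncomputable section

namespace DistComp

/-- A general correlated source with alphabets `X`, `Y`: for every blocklength `n` an arbitrary
joint distribution `P_{X^n Y^n}` on `X^n × Y^n` (no consistency between blocklengths is required). -/
structure Source (X Y : Type*) [Fintype X] [Fintype Y] where
  prob : ∀ n : ℕ, (Fin n → X) → (Fin n → Y) → ℝ
  nonneg : ∀ n x y, 0 ≤ prob n x y
  sum_eq_one : ∀ n, ∑ x, ∑ y, prob n x y = 1

/-- The prefix condition on a set of codewords. -/
def PrefixCondition (C : Set (List Bool)) : Prop :=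
  ∀ s ∈ C, ∀ t ∈ C, s <+: t → s = t

/-- A variable-length code: two separate binary encoders satisfying the prefix condition and a
decoder defined on the pairs of codewords. -/
structure Code (A B Z : Type*) where
  enc₁ : A → List Bool
  enc₂ : B → List Bool
  dec : Set.range enc₁ → Set.range enc₂ → Z
  prefix₁ : PrefixCondition (Set.range enc₁)
  prefix₂ : PrefixCondition (Set.range enc₂)

/-- The output of the decoder on the encoded pair `(x, y)`. -/
def Code.output {A B Z : Type*} (Φ : Code A B Z) (x : A) (y : B) : Z :=
  Φ.dec ⟨Φ.enc₁ x, Set.mem_range_self x⟩ ⟨Φ.enc₂ y, Set.mem_range_self y⟩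

/-- Both encoders have codewords of one common length each. -/
def Code.IsFixedLength {A B Z : Type*} (Φ : Code A B Z) : Prop :=
  (∃ l : ℕ, ∀ x, (Φ.enc₁ x).length = l) ∧ (∃ l : ℕ, ∀ y, (Φ.enc₂ y).length = l)

/-- The two kinds of coding: fixed-length and variable-length. -/
inductive CodingKind
  | fl
  | vl

/-- Codes that are allowed for a kind of coding. -/
def Code.Allowed {A B Z : Type*} (Φ : Code A B Z) : CodingKind → Prop
  | .fl => Φ.IsFixedLength
  | .vl => True

section Regions

variable {X Y : Type*} [Fintype X] [Fintype Y]

/-- Average codeword length of the first encoder at blocklength `n`. -/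
def Source.avgLength₁ (P : Source X Y) {n : ℕ} {Z : Type*}
    (Φ : Code (Fin n → X) (Fin n → Y) Z) : ℝ :=
  ∑ x, (∑ y, P.prob n x y) * ((Φ.enc₁ x).length : ℝ)

/-- Average codeword length of the second encoder at blocklength `n`. -/
def Source.avgLength₂ (P : Source X Y) {n : ℕ} {Z : Type*}
    (Φ : Code (Fin n → X) (Fin n → Y) Z) : ℝ :=
  ∑ y, (∑ x, P.prob n x y) * ((Φ.enc₂ y).length : ℝ)

open Classical in
/-- Error probability of a code for computing `f` at blocklength `n`. -/
def Source.errorProb (P : Source X Y) {n : ℕ} {Z : Type*}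
    (f : (Fin n → X) → (Fin n → Y) → Z) (Φ : Code (Fin n → X) (Fin n → Y) Z) : ℝ :=
  ∑ x, ∑ y, if f x y ≠ Φ.output x y then P.prob n x y else 0

/-- The achievable rate region for computing `f`, by fixed-length or variable-length coding.
The upper limits are taken in the extended reals. -/
def achievableRegion (k : CodingKind) (P : Source X Y) {Z : ℕ → Type*}
    (f : ∀ n, (Fin n → X) → (Fin n → Y) → Z n) : Set (ℝ × ℝ) :=
  {R | ∃ Φ : ∀ n, Code (Fin n → X) (Fin n → Y) (Z n),
    (∀ n, (Φ n).Allowed k) ∧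
    Tendsto (fun n => P.errorProb (f n) (Φ n)) atTop (nhds 0) ∧
    limsup (fun n : ℕ => ((P.avgLength₁ (Φ n) / n : ℝ) : EReal)) atTop ≤ (R.1 : EReal) ∧
    limsup (fun n : ℕ => ((P.avgLength₂ (Φ n) / n : ℝ) : EReal)) atTop ≤ (R.2 : EReal)}

/-- The Slepian-Wolf region: the achievable region for the identity functions. -/
def swRegion (k : CodingKind) (P : Source X Y) : Set (ℝ × ℝ) :=
  achievableRegion k P (Z := fun n => (Fin n → X) × (Fin n → Y)) (fun _ x y => (x, y))

/-- The Slepian-Wolf rate `R_SW(X|Y)`, with `Y` fully available at the decoder. -/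
def swRate₁ (k : CodingKind) (P : Source X Y) : ℝ :=
  sInf {R₁ : ℝ | (R₁, Real.logb 2 (Fintype.card Y)) ∈ swRegion k P}

/-- The Slepian-Wolf rate `R_SW(Y|X)`, with `X` fully available at the decoder. -/
def swRate₂ (k : CodingKind) (P : Source X Y) : ℝ :=
  sInf {R₂ : ℝ | (Real.logb 2 (Fintype.card X), R₂) ∈ swRegion k P}

/-- The outer bound on achievable regions of `r`-totally sensitive functions: the Slepian-Wolf
region with the sum rate relaxed by `r`, but without relaxing the individual rates. -/
def outerBound (k : CodingKind) (P : Source X Y) (r : ℝ) : Set (ℝ × ℝ) :=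
  {R | (∃ l : ℝ, 0 ≤ l ∧ l ≤ 1 ∧ (R.1 + l * r, R.2 + (1 - l) * r) ∈ swRegion k P) ∧
    swRate₁ k P ≤ R.1 ∧ swRate₂ k P ≤ R.2}

/-- Smoothness: changing one symbol of `y` (or one symbol of `x`) decreases the probability of
`(x, y)` at most by a constant factor `q`, which does not depend on the blocklength. -/
def Source.Smooth [DecidableEq X] [DecidableEq Y] (P : Source X Y) : Prop :=
  (∃ q : ℝ, 0 < q ∧ q < 1 ∧ ∀ (n : ℕ) (x : Fin n → X) (y y' : Fin n → Y),
    hammingDist y y' = 1 → q * P.prob n x y ≤ P.prob n x y') ∧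
  (∃ q : ℝ, 0 < q ∧ q < 1 ∧ ∀ (n : ℕ) (x x' : Fin n → X) (y : Fin n → Y),
    hammingDist x x' = 1 → q * P.prob n x y ≤ P.prob n x' y)

end Regions

/-- Sensitivity of `f` conditioned on its second argument: whenever `f x y = f x' y` and `x`, `x'`
differ in the `i`-th symbol, changing the `i`-th symbol of `y` suitably makes the values differ. -/
def Sensitive {X Y Z : Type*} {n : ℕ} (f : (Fin n → X) → (Fin n → Y) → Z) : Prop :=
  ∀ (x x' : Fin n → X) (y : Fin n → Y) (i : Fin n), f x y = f x' y → x i ≠ x' i →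
    ∃ y' : Fin n → Y, y' i ≠ y i ∧ (∀ j, j ≠ i → y' j = y j) ∧ f x y' ≠ f x' y'

/-- `EQ(z|f)`: the maximal number `J` of pairs `(x_j, y_j)` with pairwise distinct `x_j`, pairwise
distinct `y_j` and `f x_j y_j = z` for all `j`. -/
def eqNumber {A B Z : Type*} (f : A → B → Z) (z : Z) : ℕ :=
  sSup {J : ℕ | ∃ (x : Fin J → A) (y : Fin J → B),
    Function.Injective x ∧ Function.Injective y ∧ ∀ j, f (x j) (y j) = z}

/-- `r`-total sensitivity of a sequence of functions. -/
def RTotallySensitive {X Y : Type*} {Z : ℕ → Type*} (r : ℝ)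
    (f : ∀ n, (Fin n → X) → (Fin n → Y) → Z n) : Prop :=
  limsup (fun n : ℕ =>
    ((Real.logb 2 ((⨆ z : Z n, eqNumber (f n) z : ℕ) : ℝ) / n : ℝ) : EReal)) atTop ≤ (r : EReal) ∧
  (∀ n, Sensitive (f n)) ∧ (∀ n, Sensitive (fun y x => f n x y))

/-- The function which outputs, for each of the first `⌊nρ⌋` coordinates, the sum of the two symbols
in the field with `p` elements (the alphabets being embedded by `a` and `b`), and for each of the
remaining coordinates the pair of symbols itself. -/
def partialSum {X Y : Type*} {p : ℕ} (a : X ↪ ZMod p) (b : Y ↪ ZMod p) (ρ : ℝ) (n : ℕ)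
    (x : Fin n → X) (y : Fin n → Y) : Fin n → ZMod p ⊕ (X × Y) :=
  fun i => if (i : ℕ) < ⌊(n : ℝ) * ρ⌋₊ then Sum.inl (a (x i) + b (y i)) else Sum.inr (x i, y i)

end DistComp

end

open DistComp

open Filter

namespace DistComp

/-! The source is built so that the sum of the symbols is almost free to describe while the pair is
not. The smaller alphabet is matched into the larger one, and the embeddings are chosen so that
matched symbols have sum zero. Coordinates are independent. In the head (the first `⌊nρ⌋`) matched
pairs have weight 1 and all others a small weight ε > 0, which keeps the source smooth; in the tail
the pairs are uniform.

Achievability is the Körner–Marton scheme. The head sum has Hamming weight at most τn except with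
exponentially small probability (`errorProb_matchedSource_le`). Both encoders send the syndrome of
their head under one linear code correcting τn errors. The syndromes add up to that of the sum, so
the decoder finds the sum (`exists_code_partialSum`). By Gilbert–Varshamov
(`exists_submodule_hammingNorm`) the syndrome costs at most δn bits if τ is small. The tail is sent
uncoded.

The converse uses min-entropy and counting (`le_expected_length`), so it covers variable-length
codes. A head pair has probability at most 1/min(|X|,|Y|), so recovering both sequences needs the
full sum rate r + (1-ρ) log|X||Y|, even without the loss δ. The individual rates are bounded through
the uniform tail alone (`swRegion_matchedSource_subset`).

The function is injective in each argument, which makes sensitivity vacuous, and pairs with a common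
value agree on the tail, which bounds EQ. Finally, the individual-rate constraints of the outer
bound force R₁ ≥ (1-ρ) log|X| and R₂ ≥ (1-ρ) log|Y|, so adding δ to both rates lands in the
achievable rectangle. -/

/-! ### Factorization of sums over sequences -/

theorem sum_prod_apply {n : ℕ} {A : Type*} [Fintype A] (g : Fin n → A → ℝ) :
    ∑ x : Fin n → A, ∏ i, g i (x i) = ∏ i, ∑ a, g i a := by
  classical
  rw [Finset.prod_univ_sum, Fintype.piFinset_univ]

theorem sum_sum_prod_apply {n : ℕ} {A B : Type*} [Fintype A] [Fintype B]
    (g : Fin n → A → B → ℝ) :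
    ∑ x : Fin n → A, ∑ y : Fin n → B, ∏ i, g i (x i) (y i) = ∏ i, ∑ a, ∑ b, g i a b := by
  simp_rw [fun x : Fin n → A => sum_prod_apply (fun i b => g i (x i) b)]
  exact sum_prod_apply (fun i a => ∑ b, g i a b)

/-! ### Fixed-length codes -/

theorem exists_embedding_list_bool (G : Type*) [Fintype G] :
    ∃ e : G → List Bool, Function.Injective e ∧
      ∀ g, (e g).length = Nat.clog 2 (Fintype.card G) := by
  have hc : Fintype.card G ≤ Fintype.card (Fin (Nat.clog 2 (Fintype.card G)) → Bool) := by
    simpa using Nat.le_pow_clog (by norm_num : 1 < 2) (Fintype.card G)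
  obtain ⟨e⟩ := Function.Embedding.nonempty_of_card_le hc
  exact ⟨fun g => List.ofFn (e g), fun g h hgh => e.injective (List.ofFn_injective hgh),
    fun g => by simp⟩

theorem prefixCondition_of_length {C : Set (List Bool)} {l : ℕ} (h : ∀ s ∈ C, s.length = l) :
    PrefixCondition C :=
  fun s hs t ht hst => hst.eq_of_length ((h s hs).trans (h t ht).symm)

/-- Any pair of quantizers `g₁`, `g₂` followed by a joint map `d` is realized by a fixed-length
code. -/
theorem exists_fixedLength_code {A B Z G₁ G₂ : Type*} [Fintype G₁] [Fintype G₂]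
    (g₁ : A → G₁) (g₂ : B → G₂) (d : G₁ → G₂ → Z) :
    ∃ Φ : Code A B Z, (∀ x, (Φ.enc₁ x).length = Nat.clog 2 (Fintype.card G₁)) ∧
      (∀ y, (Φ.enc₂ y).length = Nat.clog 2 (Fintype.card G₂)) ∧
      ∀ x y, Φ.output x y = d (g₁ x) (g₂ y) := by
  obtain ⟨e₁, h₁, l₁⟩ := exists_embedding_list_bool G₁
  obtain ⟨e₂, h₂, l₂⟩ := exists_embedding_list_bool G₂
  -- The decoder evaluates `d` at arbitrary preimages of the codewords; since `e₁` and `e₂` are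
  -- injective, the choice does not affect the quantized values.
  refine ⟨⟨e₁ ∘ g₁, e₂ ∘ g₂, fun s t => d (g₁ s.2.choose) (g₂ t.2.choose),
    prefixCondition_of_length (l := Nat.clog 2 (Fintype.card G₁)) ?_,
    prefixCondition_of_length (l := Nat.clog 2 (Fintype.card G₂)) ?_⟩,
    fun x => l₁ _, fun y => l₂ _, fun x y => ?_⟩
  · rintro _ ⟨x, rfl⟩; exact l₁ _
  · rintro _ ⟨x, rfl⟩; exact l₂ _
  · have hx : ∃ x', (e₁ ∘ g₁) x' = (e₁ ∘ g₁) x := ⟨x, rfl⟩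
    have hy : ∃ y', (e₂ ∘ g₂) y' = (e₂ ∘ g₂) y := ⟨y, rfl⟩
    change d (g₁ hx.choose) (g₂ hy.choose) = _
    rw [h₁ hx.choose_spec, h₂ hy.choose_spec]

theorem natCast_clog_le (N : ℕ) (hN : 1 ≤ N) :
    (Nat.clog 2 N : ℝ) ≤ Real.logb 2 N + 1 := by
  rw [← Real.natCeil_logb_natCast]
  exact (Nat.ceil_lt_add_one (Real.logb_nonneg (by norm_num) (by exact_mod_cast hN))).le

/-! ### Subspaces of large minimum distance -/

/-- Gilbert–Varshamov: a subspace of minimum distance larger than `s` whose index is at most the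
size of a Hamming ball of radius `s`. -/
theorem exists_submodule_hammingNorm {F : Type*} [Field F] [Fintype F] [DecidableEq F] (n : ℕ)
    (s : ℝ) (hs : 0 ≤ s) :
    ∃ V : Submodule F (Fin n → F), (∀ v ∈ V, (hammingNorm v : ℝ) ≤ s → v = 0) ∧
      Nat.card ((Fin n → F) ⧸ V) ≤ Nat.card {v : Fin n → F // (hammingNorm v : ℝ) ≤ s} := by
  classical
  -- For a maximal such subspace every coset meets the ball, so the ball maps onto the quotient. If
  -- the coset of u missed it, u could be adjoined to V: a vector v + cu with c ≠ 0 has the weight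
  -- of its multiple by c⁻¹, which lies in the coset of u.
  obtain ⟨V, hV, hmax⟩ := (Set.toFinite {V : Submodule F (Fin n → F) |
    ∀ v ∈ V, (hammingNorm v : ℝ) ≤ s → v = 0}).exists_maximal
      ⟨⊥, fun v hv _ => by simpa using hv⟩
  refine ⟨V, hV, ?_⟩
  have hsurj : Function.Surjective
      (fun v : {v : Fin n → F // (hammingNorm v : ℝ) ≤ s} => V.mkQ v.1) := by
    intro q
    obtain ⟨u, rfl⟩ := V.mkQ_surjective q
    by_contra hu
    push Not at hu
    have hW : ∀ v ∈ V ⊔ Submodule.span F {u}, (hammingNorm v : ℝ) ≤ s → v = 0 := by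
      intro w hw hws
      obtain ⟨v, hv, z, hz, rfl⟩ := Submodule.mem_sup.1 hw
      obtain ⟨c, rfl⟩ := Submodule.mem_span_singleton.1 hz
      by_cases hc : c = 0
      · subst hc
        rw [zero_smul, add_zero] at hws ⊢
        exact hV v hv hws
      · exfalso
        refine hu ⟨c⁻¹ • (v + c • u), ?_⟩ ?_
        · rwa [hammingNorm_smul fun i => (IsUnit.mk0 _ (inv_ne_zero hc)).isSMulRegular F]
        · change V.mkQ (c⁻¹ • (v + c • u)) = V.mkQ u
          rw [smul_add, smul_smul, inv_mul_cancel₀ hc, one_smul, map_add, map_smul]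
          simp [(Submodule.Quotient.mk_eq_zero V).2 hv]
    have hle := hmax (y := V ⊔ Submodule.span F {u}) hW le_sup_left
    have huV : u ∈ V := hle (Submodule.mem_sup_right (Submodule.mem_span_singleton_self u))
    refine hu ⟨0, by simpa using hs⟩ ?_
    simp [(Submodule.Quotient.mk_eq_zero V).2 huV]
  exact Nat.card_le_card_of_surjective _ hsurj

/-- Weight each vector by β to the power of its Hamming weight: vectors in the ball weigh at least
β^s, and the total weight factorizes over the coordinates. -/
theorem card_hammingBall_mul_rpow_le {F : Type*} [Field F] [Fintype F] [DecidableEq F] (n : ℕ)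
    (s β : ℝ) (hβ : 0 < β) (hβ1 : β ≤ 1) :
    (Nat.card {v : Fin n → F // (hammingNorm v : ℝ) ≤ s} : ℝ) * β ^ s ≤
      (1 + Fintype.card F * β) ^ n := by
  classical
  have h1 : ∑ v : Fin n → F, β ^ hammingNorm v = (∑ c : F, if c ≠ 0 then β else 1) ^ n := by
    have := sum_prod_apply (fun (_ : Fin n) (c : F) => if c ≠ 0 then β else 1)
    rw [Finset.prod_const, Finset.card_univ, Fintype.card_fin] at this
    rw [← this]
    refine Finset.sum_congr rfl fun v _ => ?_
    rw [Finset.prod_ite]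
    simp [hammingNorm]
  have h2 : (∑ c : F, if c ≠ 0 then β else 1) ≤ 1 + Fintype.card F * β := by
    calc (∑ c : F, if c ≠ 0 then β else 1) ≤ ∑ c : F, ((if c = 0 then 1 else 0) + β) := by
          refine Finset.sum_le_sum fun c _ => ?_
          by_cases hc : c = 0 <;> simp [hc, hβ.le]
      _ = _ := by simp [Finset.sum_add_distrib]
  have h0 : 0 ≤ ∑ c : F, if c ≠ 0 then β else 1 :=
    Finset.sum_nonneg fun c _ => by split_ifs <;> linarith
  refine le_trans ?_ (pow_le_pow_left₀ h0 h2 n)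
  rw [← h1, Nat.card_eq_fintype_card, Fintype.card_subtype, ← nsmul_eq_mul, ← Finset.sum_const]
  calc _ ≤ ∑ v ∈ Finset.univ.filter (fun v : Fin n → F => (hammingNorm v : ℝ) ≤ s),
        β ^ hammingNorm v := by
        refine Finset.sum_le_sum fun v hv => ?_
        rw [← Real.rpow_natCast]
        exact Real.rpow_le_rpow_of_exponent_ge hβ hβ1 (Finset.mem_filter.1 hv).2
    _ ≤ _ := Finset.sum_le_sum_of_subset_of_nonneg (Finset.filter_subset _ _)
        fun v _ _ => by positivity

/-- Hamming balls of small relative radius have small exponential growth rate. -/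
theorem exists_card_hammingBall_le (F : Type*) [Field F] [Fintype F] [DecidableEq F] (κ : ℝ)
    (hκ : 0 < κ) :
    ∃ τ : ℝ, 0 < τ ∧ ∀ n : ℕ,
      (Nat.card {v : Fin n → F // (hammingNorm v : ℝ) ≤ 2 * (τ * n)} : ℝ) ≤ 2 ^ (κ * n) := by
  have hF : (0 : ℝ) < Fintype.card F := by exact_mod_cast Fintype.card_pos
  have hg : (0 : ℝ) < 2 ^ (κ / 2) - 1 := by
    have := Real.one_lt_rpow (by norm_num : (1 : ℝ) < 2) (half_pos hκ)
    linarith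
  -- β is small enough that 1 + |F|β ≤ 2^(κ/2). Then τ is fixed by β^(2τn) = 2^(-κn/2), and the two
  -- halves combine to 2^(κn).
  obtain ⟨β, hβ0, hβ⟩ : ∃ β, β = min (1 / 2) ((2 ^ (κ / 2) - 1) / Fintype.card F : ℝ) ∧ 0 < β :=
    ⟨_, rfl, lt_min (by norm_num) (div_pos hg hF)⟩
  have hβ2 : β ≤ 1 / 2 := hβ0 ▸ min_le_left _ _
  have hβF : 1 + Fintype.card F * β ≤ 2 ^ (κ / 2) := by
    have : β ≤ (2 ^ (κ / 2) - 1) / Fintype.card F := hβ0 ▸ min_le_right _ _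
    rw [le_div_iff₀ hF] at this
    linarith
  have hl : Real.logb 2 β < 0 := Real.logb_neg (by norm_num) hβ (by linarith)
  refine ⟨κ / 4 / (-Real.logb 2 β), by have := neg_pos.2 hl; positivity, fun n => ?_⟩
  have h := card_hammingBall_mul_rpow_le (F := F) n (2 * (κ / 4 / (-Real.logb 2 β) * n)) β hβ
    (by linarith)
  have h3 : β ^ (2 * (κ / 4 / (-Real.logb 2 β) * n)) = (2 : ℝ) ^ (-(κ / 2 * n)) := by
    have hb := Real.rpow_logb (by norm_num : (0 : ℝ) < 2) (by norm_num) hβ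
    generalize Real.logb 2 β = b at hl hb ⊢
    rw [← hb, ← Real.rpow_mul (by norm_num)]
    congr 1
    have := hl.ne
    field_simp
    ring
  have h4 : (1 + Fintype.card F * β) ^ n ≤ (2 : ℝ) ^ (κ / 2 * n) := by
    rw [Real.rpow_mul (by norm_num), Real.rpow_natCast]
    exact pow_le_pow_left₀ (by positivity) hβF n
  rw [h3, Real.rpow_neg (by norm_num), ← div_eq_mul_inv, div_le_iff₀ (by positivity)] at h
  refine h.trans ((mul_le_mul_of_nonneg_right h4 (by positivity)).trans_eq ?_)
  rw [← Real.rpow_add (by norm_num)]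
  ring_nf

/-! ### Lower bounds on expected lengths -/

theorem card_lists_length_lt (l : ℕ) (S : Finset (List Bool)) (hS : ∀ s ∈ S, s.length < l) :
    S.card ≤ 2 ^ l := by
  -- There are 2^l - 1 strings shorter than l; the sharper count is what the induction needs, as the
  -- empty string is added at each step.
  suffices h : ∃ T : Finset (List Bool), (∀ s : List Bool, s.length < l → s ∈ T) ∧
      T.card + 1 ≤ 2 ^ l by
    obtain ⟨T, hT, hc⟩ := h
    exact (Finset.card_le_card fun s hs => hT s (hS s hs)).trans (by omega)
  clear hS S
  induction l with
  | zero => exact ⟨∅, by simp, by simp⟩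
  | succ l ih =>
    obtain ⟨T, hT, hc⟩ := ih
    refine ⟨insert [] (T.image (List.cons true) ∪ T.image (List.cons false)), ?_, ?_⟩
    · rintro (_ | ⟨_ | _, s⟩) hs
      · simp
      · simpa using hT s (by simpa using hs)
      · simpa using hT s (by simpa using hs)
    · have h1 := Finset.card_insert_le [] (T.image (List.cons true) ∪ T.image (List.cons false))
      have h2 := Finset.card_union_le (T.image (List.cons true)) (T.image (List.cons false))
      have h3 := Finset.card_image_le (s := T) (f := List.cons true)
      have h4 := Finset.card_image_le (s := T) (f := List.cons false)
      rw [pow_succ]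
      omega

/-- If the codeword together with side information `t` determines the outcome on `D`, and the
conditional probabilities of outcomes are at most `1 / M`, the expected length is large. -/
theorem le_expected_length {Ω T : Type*} [Fintype Ω] [Fintype T] (P : Ω → ℝ)
    (hP : ∀ ω, 0 ≤ P ω) (D : Finset Ω) (t : Ω → T) (c : Ω → List Bool)
    (hinj : Set.InjOn (fun ω => (t ω, c ω)) D) (u : T → ℝ) (hu0 : ∀ b, 0 ≤ u b)
    (hu : ∑ b, u b ≤ 1) (M : ℝ) (hM : 0 < M) (hPu : ∀ ω, P ω ≤ u (t ω) / M) (l : ℕ) :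
    l * (∑ ω ∈ D, P ω - 2 ^ l / M) ≤ ∑ ω, P ω * ((c ω).length : ℝ) := by
  classical
  -- For each value b of the side information, fewer than 2^l outcomes of D have a codeword shorter
  -- than l, each of probability at most u(b)/M. Summing over b, short codewords have total
  -- probability at most 2^l/M.
  have hA : ∑ ω ∈ D.filter (fun ω => (c ω).length < l), P ω ≤ 2 ^ l / M := by
    calc ∑ ω ∈ D.filter (fun ω => (c ω).length < l), P ω
        ≤ ∑ ω ∈ D.filter (fun ω => (c ω).length < l), u (t ω) / M :=
          Finset.sum_le_sum fun ω _ => hPu ω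
      _ = ∑ b, ∑ ω ∈ (D.filter (fun ω => (c ω).length < l)).filter (fun ω => t ω = b),
            u (t ω) / M := (Finset.sum_fiberwise _ _ _).symm
      _ ≤ ∑ b, 2 ^ l * (u b / M) := by
          refine Finset.sum_le_sum fun b _ => ?_
          rw [Finset.sum_congr rfl (g := fun _ => u b / M)
            (fun ω hω => by rw [(Finset.mem_filter.1 hω).2]), Finset.sum_const, nsmul_eq_mul]
          refine mul_le_mul_of_nonneg_right ?_ (div_nonneg (hu0 b) hM.le)
          have hci : Set.InjOn c
              ((D.filter (fun ω => (c ω).length < l)).filter (fun ω => t ω = b) : Finset Ω) := by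
            intro ω hω ω' hω' h
            simp only [Finset.coe_filter, Finset.mem_filter, Set.mem_ofPred_eq] at hω hω'
            exact hinj hω.1.1 hω'.1.1 (Prod.ext (hω.2.trans hω'.2.symm) h)
          have := card_lists_length_lt l (S := ((D.filter
            (fun ω => (c ω).length < l)).filter (fun ω => t ω = b)).image c) (by
              intro s hs
              obtain ⟨ω, hω, rfl⟩ := Finset.mem_image.1 hs
              exact (Finset.mem_filter.1 (Finset.mem_filter.1 hω).1).2)
          rw [Finset.card_image_of_injOn hci] at this
          exact_mod_cast this
      _ = 2 ^ l / M * ∑ b, u b := by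
          rw [Finset.mul_sum]
          exact Finset.sum_congr rfl fun b _ => by ring
      _ ≤ 2 ^ l / M := mul_le_of_le_one_right (by positivity) hu
  have hsplit := Finset.sum_filter_add_sum_filter_not D (fun ω => (c ω).length < l) P
  calc l * (∑ ω ∈ D, P ω - 2 ^ l / M)
      ≤ l * ∑ ω ∈ D.filter (fun ω => ¬ (c ω).length < l), P ω :=
        mul_le_mul_of_nonneg_left (by linarith) (Nat.cast_nonneg l)
    _ = ∑ ω ∈ D.filter (fun ω => ¬ (c ω).length < l), P ω * l := by
        rw [mul_comm, Finset.sum_mul]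
    _ ≤ ∑ ω ∈ D.filter (fun ω => ¬ (c ω).length < l), P ω * ((c ω).length : ℝ) := by
        refine Finset.sum_le_sum fun ω hω => mul_le_mul_of_nonneg_left ?_ (hP ω)
        exact_mod_cast not_lt.1 (Finset.mem_filter.1 hω).2
    _ ≤ _ := Finset.sum_le_sum_of_subset_of_nonneg (Finset.subset_univ _)
        fun ω _ _ => mul_nonneg (hP ω) (Nat.cast_nonneg _)

/-! ### Passage from finite blocklengths to rates -/

theorem eventually_lt_of_limsup_le {a : ℕ → ℝ} {R : ℝ}
    (h : limsup (fun n => ((a n : ℝ) : EReal)) atTop ≤ (R : EReal)) (γ : ℝ) (hγ : 0 < γ) :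
    ∀ᶠ n in atTop, a n < R + γ := by
  have h' : limsup (fun n => ((a n : ℝ) : EReal)) atTop < ((R + γ : ℝ) : EReal) :=
    h.trans_lt (by exact_mod_cast lt_add_of_pos_right R hγ)
  filter_upwards [eventually_lt_of_limsup_lt h'] with n hn
  exact_mod_cast hn

theorem limsup_le_of_tendsto {a b : ℕ → ℝ} {R : ℝ} (hab : ∀ᶠ n in atTop, a n ≤ b n)
    (hb : Tendsto b atTop (nhds R)) :
    limsup (fun n => ((a n : ℝ) : EReal)) atTop ≤ (R : EReal) := by
  have hb' : Tendsto (fun n => ((b n : ℝ) : EReal)) atTop (nhds (R : EReal)) :=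
    (continuous_coe_real_ereal.tendsto R).comp hb
  rw [← hb'.limsup_eq]
  refine limsup_le_limsup ?_
  filter_upwards [hab] with n hn
  exact_mod_cast hn

/-- If R < G, take g strictly between and l = ⌊gn⌋. Then 2^l is exponentially smaller than 2^(nG-c),
so E n / n is asymptotically at least g > R. The constant c absorbs the rounding of the head length.
-/
theorem le_of_expected_length_bound (E err : ℕ → ℝ) (G c R : ℝ)
    (hE : ∀ n l : ℕ, l * (1 - err n - 2 ^ l / 2 ^ (n * G - c)) ≤ E n)
    (herr : Tendsto err atTop (nhds 0))
    (hR : ∀ γ : ℝ, 0 < γ → ∀ᶠ n : ℕ in atTop, E n / n < R + γ) : G ≤ R := by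
  by_contra! hRG
  -- The bound with l = 0 says that E n is nonnegative; hence g ≥ 0 and the natural-number floor
  -- behaves as intended.
  have hR0 : 0 ≤ R := by
    refine le_of_forall_pos_lt_add fun γ hγ => ?_
    obtain ⟨n, hn⟩ := (hR γ hγ).exists
    refine lt_of_le_of_lt (div_nonneg ?_ (Nat.cast_nonneg n)) hn
    simpa using hE n 0
  obtain ⟨g, hRg, hgG⟩ := exists_between hRG
  have hg : 0 ≤ g := hR0.trans hRg.le
  have hsmall : Tendsto (fun n : ℕ => (2 : ℝ) ^ ⌊g * n⌋₊ / 2 ^ (n * G - c)) atTop (nhds 0) := by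
    have hpow : Tendsto (fun n : ℕ => (2 : ℝ) ^ c * ((2 : ℝ) ^ (g - G)) ^ n) atTop (nhds 0) := by
      simpa using (tendsto_pow_atTop_nhds_zero_of_lt_one (by positivity)
        (Real.rpow_lt_one_of_one_lt_of_neg (by norm_num) (by linarith :
          g - G < 0))).const_mul ((2 : ℝ) ^ c)
    refine squeeze_zero (fun n => by positivity) (fun n => ?_) hpow
    rw [← Real.rpow_natCast, ← Real.rpow_natCast, ← Real.rpow_sub (by norm_num),
      ← Real.rpow_mul (by norm_num), ← Real.rpow_add (by norm_num)]
    refine Real.rpow_le_rpow_of_exponent_le (by norm_num) ?_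
    have := Nat.floor_le (mul_nonneg hg (Nat.cast_nonneg n))
    nlinarith
  have hlim : Tendsto (fun n : ℕ => (⌊g * n⌋₊ : ℝ) / n *
      (1 - err n - 2 ^ ⌊g * n⌋₊ / 2 ^ (n * G - c))) atTop (nhds (g * (1 - 0 - 0))) :=
    ((tendsto_nat_floor_mul_div_atTop hg).comp tendsto_natCast_atTop_atTop).mul
      ((tendsto_const_nhds.sub herr).sub hsmall)
  have hle : g * (1 - 0 - 0) ≤ R + (g - R) / 2 := by
    refine le_of_tendsto hlim ?_
    filter_upwards [hR ((g - R) / 2) (by linarith)] with n hn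
    refine le_trans ?_ hn.le
    rw [div_mul_eq_mul_div]
    exact div_le_div_of_nonneg_right (hE n _) (Nat.cast_nonneg n)
  linarith

/-! ### The source -/

section Construction

variable {X Y : Type*} {p : ℕ}

/-- The weight of a pair of symbols: `1` if their sum vanishes and `ε` otherwise. -/
noncomputable def pairWeight (a : X ↪ ZMod p) (b : Y ↪ ZMod p) (ε : ℝ) (x : X) (y : Y) : ℝ :=
  if a x + b y = 0 then 1 else ε

variable (a : X ↪ ZMod p) (b : Y ↪ ZMod p) {ε : ℝ}

theorem pairWeight_pos (hε : 0 < ε) (x : X) (y : Y) : 0 < pairWeight a b ε x y := by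
  unfold pairWeight
  split_ifs <;> linarith

theorem pairWeight_le_one (hε1 : ε ≤ 1) (x : X) (y : Y) : pairWeight a b ε x y ≤ 1 := by
  unfold pairWeight
  split_ifs <;> linarith

theorem le_pairWeight (hε1 : ε ≤ 1) (x : X) (y : Y) : ε ≤ pairWeight a b ε x y := by
  unfold pairWeight
  split_ifs <;> linarith

variable [Fintype X] [Fintype Y]

/-- The distribution of the `i`-th pair of symbols: proportional to `pairWeight` for `i < m`, and
uniform for `i ≥ m`. -/
noncomputable def coordDist (ε : ℝ) (m i : ℕ) (x : X) (y : Y) : ℝ :=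
  if i < m then pairWeight a b ε x y / ∑ x', ∑ y', pairWeight a b ε x' y'
  else 1 / ((Fintype.card X : ℝ) * Fintype.card Y)

theorem coordDist_nonneg (hε : 0 < ε) (m i : ℕ) (x : X) (y : Y) :
    0 ≤ coordDist a b ε m i x y := by
  have := fun x y => (pairWeight_pos a b hε x y).le
  unfold coordDist
  split_ifs
  · exact div_nonneg (this x y) (Finset.sum_nonneg fun x _ => Finset.sum_nonneg fun y _ => this x y)
  · positivity

theorem sum_coordDist [Nonempty X] [Nonempty Y] (hε : 0 < ε) (m i : ℕ) :
    ∑ x, ∑ y, coordDist a b ε m i x y = 1 := by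
  have := pairWeight_pos a b hε
  unfold coordDist
  split_ifs
  · simp_rw [← Finset.sum_div]
    refine div_self (ne_of_gt (Finset.sum_pos (fun x _ => Finset.sum_pos (fun y _ => this x y)
      Finset.univ_nonempty) Finset.univ_nonempty))
  · simp

/-- The product source with coordinate distributions `coordDist`. -/
noncomputable def matchedSource [Nonempty X] [Nonempty Y] (hε : 0 < ε) (ρ : ℝ) : Source X Y where
  prob n x y := ∏ i : Fin n, coordDist a b ε ⌊(n : ℝ) * ρ⌋₊ i (x i) (y i)
  nonneg n x y := Finset.prod_nonneg fun i _ => coordDist_nonneg a b hε _ _ _ _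
  sum_eq_one n := by
    rw [sum_sum_prod_apply (fun (i : Fin n) x y => coordDist a b ε ⌊(n : ℝ) * ρ⌋₊ i x y)]
    exact Finset.prod_eq_one fun i _ => sum_coordDist a b hε _ _

/-- Only one factor of the product changes, so comparability of single factors suffices for
smoothness. -/
theorem mul_prod_le_of_hammingDist_eq_one {A : Type*} [DecidableEq A] {n : ℕ}
    (h : Fin n → A → ℝ) (q : ℝ) (h0 : ∀ i c, 0 ≤ h i c) (hq : ∀ i c c', q * h i c ≤ h i c')
    (y y' : Fin n → A) (hy : hammingDist y y' = 1) :
    q * ∏ i, h i (y i) ≤ ∏ i, h i (y' i) := by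
  obtain ⟨i, hi⟩ := Finset.card_eq_one.1 hy
  have hj : ∀ j ∈ Finset.univ.erase i, h j (y j) = h j (y' j) := by
    intro j hj
    have : j ∉ ({i} : Finset (Fin n)) := by simpa using hj
    rw [← hi] at this
    have hyj : y j = y' j := by simpa using this
    rw [hyj]
  rw [← Finset.mul_prod_erase _ _ (Finset.mem_univ i),
    ← Finset.mul_prod_erase _ _ (Finset.mem_univ i), Finset.prod_congr rfl hj, ← mul_assoc]
  exact mul_le_mul_of_nonneg_right (hq _ _ _) (Finset.prod_nonneg fun _ _ => h0 _ _)

theorem mul_coordDist_le (hε : 0 < ε) (hε1 : ε ≤ 1) (m i : ℕ) (x x' : X) (y y' : Y) :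
    ε * coordDist a b ε m i x y ≤ coordDist a b ε m i x' y' := by
  have h0 := fun x y => (pairWeight_pos a b hε x y).le
  unfold coordDist
  split_ifs
  · rw [← mul_div_assoc]
    refine div_le_div_of_nonneg_right ?_
      (Finset.sum_nonneg fun x _ => Finset.sum_nonneg fun y _ => h0 x y)
    exact (mul_le_of_le_one_right hε.le (pairWeight_le_one a b hε1 x y)).trans
      (le_pairWeight a b hε1 x' y')
  · exact mul_le_of_le_one_left (by positivity) hε1

theorem smooth_matchedSource [Nonempty X] [Nonempty Y] [DecidableEq X] [DecidableEq Y]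
    (hε : 0 < ε) (hε1 : ε < 1) (ρ : ℝ) : (matchedSource a b hε ρ).Smooth := by
  refine ⟨⟨ε, hε, hε1, fun n x y y' hy => ?_⟩, ⟨ε, hε, hε1, fun n x x' y hx => ?_⟩⟩
  · exact mul_prod_le_of_hammingDist_eq_one
      (fun i c => coordDist a b ε ⌊(n : ℝ) * ρ⌋₊ i (x i) c) ε
      (fun i c => coordDist_nonneg a b hε _ _ _ _)
      (fun i c c' => mul_coordDist_le a b hε hε1.le _ _ _ _ _ _) y y' hy
  · exact mul_prod_le_of_hammingDist_eq_one
      (fun i c => coordDist a b ε ⌊(n : ℝ) * ρ⌋₊ i c (y i)) ε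
      (fun i c => coordDist_nonneg a b hε _ _ _ _)
      (fun i c c' => mul_coordDist_le a b hε hε1.le _ _ _ _ _ _) x x' hx

/-- Inject the smaller alphabet into the larger by σ, embed the larger in the field, and embed the
smaller by the negative of the composite. Every symbol of the smaller alphabet then has a partner
with sum zero. -/
theorem exists_matching_embeddings (X Y : Type*) [Fintype X] [Fintype Y] :
    ∃ (p : ℕ) (_ : p.Prime) (a : X ↪ ZMod p) (b : Y ↪ ZMod p),
      min (Fintype.card X : ℝ) (Fintype.card Y) ≤
        ∑ x, ∑ y, if a x + b y = 0 then (1 : ℝ) else 0 := by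
  classical
  obtain ⟨p, hp, hprime⟩ := Nat.exists_infinite_primes (Fintype.card X + Fintype.card Y)
  have : Fact p.Prime := ⟨hprime⟩
  rcases le_total (Fintype.card X) (Fintype.card Y) with h | h
  · obtain ⟨σ⟩ := Function.Embedding.nonempty_of_card_le h
    obtain ⟨b⟩ := Function.Embedding.nonempty_of_card_le
      (show Fintype.card Y ≤ Fintype.card (ZMod p) by rw [ZMod.card]; omega)
    refine ⟨p, hprime, (σ.trans b).trans (Equiv.neg _).toEmbedding, b, (min_le_left _ _).trans ?_⟩
    rw [← nsmul_one, ← Finset.card_univ, ← Finset.sum_const]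
    refine Finset.sum_le_sum fun x _ => ?_
    refine le_trans ?_ (Finset.single_le_sum (fun y _ => ?_) (Finset.mem_univ (σ x)))
    · simp
    · split_ifs <;> norm_num
  · obtain ⟨σ⟩ := Function.Embedding.nonempty_of_card_le h
    obtain ⟨a⟩ := Function.Embedding.nonempty_of_card_le
      (show Fintype.card X ≤ Fintype.card (ZMod p) by rw [ZMod.card]; omega)
    refine ⟨p, hprime, a, (σ.trans a).trans (Equiv.neg _).toEmbedding, (min_le_right _ _).trans ?_⟩
    rw [← nsmul_one, ← Finset.card_univ, ← Finset.sum_const, Finset.sum_comm]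
    refine Finset.sum_le_sum fun y _ => ?_
    refine le_trans ?_ (Finset.single_le_sum (fun x _ => ?_) (Finset.mem_univ (σ y)))
    · simp
    · split_ifs <;> norm_num

theorem le_sum_pairWeight (hε : 0 < ε) :
    (∑ x, ∑ y, if a x + b y = 0 then (1 : ℝ) else 0) ≤ ∑ x, ∑ y, pairWeight a b ε x y := by
  refine Finset.sum_le_sum fun x _ => Finset.sum_le_sum fun y _ => ?_
  unfold pairWeight
  split_ifs <;> linarith

end Construction

/-! ### Converse -/

section Converse

variable {X Y : Type*} [Fintype X] [Fintype Y]

theorem Code.output_congr {A B Z : Type*} (Φ : Code A B Z) {x x' : A} {y y' : B}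
    (hx : Φ.enc₁ x = Φ.enc₁ x') (hy : Φ.enc₂ y = Φ.enc₂ y') : Φ.output x y = Φ.output x' y' := by
  unfold Code.output
  congr 1 <;> exact Subtype.ext (by assumption)

/-- Two first codewords that are prefixes of the same string are comparable, hence equal by the
prefix condition. A pair of codewords can thus be treated as a single string in the sum-rate bound.
-/
theorem Code.append_inj {A B Z : Type*} (Φ : Code A B Z) {x x' : A} {y y' : B}
    (h : Φ.enc₁ x ++ Φ.enc₂ y = Φ.enc₁ x' ++ Φ.enc₂ y') :
    Φ.enc₁ x = Φ.enc₁ x' ∧ Φ.enc₂ y = Φ.enc₂ y' := by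
  have hx : Φ.enc₁ x = Φ.enc₁ x' := by
    have h1 : Φ.enc₁ x <+: Φ.enc₁ x ++ Φ.enc₂ y := List.prefix_append _ _
    have h2 : Φ.enc₁ x' <+: Φ.enc₁ x ++ Φ.enc₂ y := h ▸ List.prefix_append _ _
    rcases List.prefix_or_prefix_of_prefix h1 h2 with h | h
    · exact Φ.prefix₁ _ ⟨x, rfl⟩ _ ⟨x', rfl⟩ h
    · exact (Φ.prefix₁ _ ⟨x', rfl⟩ _ ⟨x, rfl⟩ h).symm
  exact ⟨hx, List.append_cancel_left (hx ▸ h)⟩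

theorem Source.sum_prob (P : Source X Y) (n : ℕ) :
    ∑ ω : (Fin n → X) × (Fin n → Y), P.prob n ω.1 ω.2 = 1 := by
  rw [Fintype.sum_prod_type, P.sum_eq_one]

theorem Source.avgLength₁_eq (P : Source X Y) {n : ℕ} {Z : Type*}
    (Φ : Code (Fin n → X) (Fin n → Y) Z) :
    P.avgLength₁ Φ = ∑ ω : (Fin n → X) × (Fin n → Y),
      P.prob n ω.1 ω.2 * ((Φ.enc₁ ω.1).length : ℝ) := by
  rw [Fintype.sum_prod_type]
  exact Finset.sum_congr rfl fun x _ => Finset.sum_mul _ _ _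

theorem Source.avgLength₂_eq (P : Source X Y) {n : ℕ} {Z : Type*}
    (Φ : Code (Fin n → X) (Fin n → Y) Z) :
    P.avgLength₂ Φ = ∑ ω : (Fin n → X) × (Fin n → Y),
      P.prob n ω.1 ω.2 * ((Φ.enc₂ ω.2).length : ℝ) := by
  rw [Fintype.sum_prod_type_right]
  exact Finset.sum_congr rfl fun x _ => Finset.sum_mul _ _ _

/-- Here D is the set of correctly decoded pairs. On it the decoder output is the pair itself, so
whatever determines the output determines the outcome. -/
theorem Source.le_sum_length (P : Source X Y) {n : ℕ}
    (Φ : Code (Fin n → X) (Fin n → Y) ((Fin n → X) × (Fin n → Y))) {T : Type*} [Fintype T]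
    (t : (Fin n → X) × (Fin n → Y) → T) (c : (Fin n → X) × (Fin n → Y) → List Bool)
    (hinj : ∀ ω ω', t ω = t ω' → c ω = c ω' → Φ.output ω.1 ω.2 = Φ.output ω'.1 ω'.2)
    (u : T → ℝ) (hu0 : ∀ b, 0 ≤ u b) (hu : ∑ b, u b ≤ 1) (M : ℝ) (hM : 0 < M)
    (hPu : ∀ ω, P.prob n ω.1 ω.2 ≤ u (t ω) / M) (l : ℕ) :
    l * (1 - P.errorProb (fun x y => (x, y)) Φ - 2 ^ l / M) ≤
      ∑ ω, P.prob n ω.1 ω.2 * ((c ω).length : ℝ) := by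
  classical
  have hD : ∑ ω ∈ Finset.univ.filter (fun ω : (Fin n → X) × (Fin n → Y) =>
      ω = Φ.output ω.1 ω.2), P.prob n ω.1 ω.2 = 1 - P.errorProb (fun x y => (x, y)) Φ := by
    have he : P.errorProb (fun x y => (x, y)) Φ =
        ∑ ω ∈ Finset.univ.filter (fun ω : (Fin n → X) × (Fin n → Y) =>
          ¬ ω = Φ.output ω.1 ω.2), P.prob n ω.1 ω.2 := by
      rw [Finset.sum_filter, Fintype.sum_prod_type]
      unfold Source.errorProb
      refine Finset.sum_congr rfl fun x _ => Finset.sum_congr rfl fun y _ => ?_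
      congr
    rw [he, eq_sub_iff_add_eq, Finset.sum_filter_add_sum_filter_not, P.sum_prob]
  rw [← hD]
  refine le_expected_length (fun ω => P.prob n ω.1 ω.2) (fun ω => P.nonneg _ _ _) _ t c ?_ u hu0 hu
    M hM hPu l
  intro ω hω ω' hω' h
  have h1 : ω = Φ.output ω.1 ω.2 := by simpa using hω
  have h2 : ω' = Φ.output ω'.1 ω'.2 := by simpa using hω'
  rw [h1, h2]
  exact hinj ω ω' (congrArg Prod.fst h) (congrArg Prod.snd h)

theorem card_filter_lt_floor {n : ℕ} {ρ : ℝ} (hρ1 : ρ ≤ 1) :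
    (Finset.univ.filter fun i : Fin n => (i : ℕ) < ⌊(n : ℝ) * ρ⌋₊).card = ⌊(n : ℝ) * ρ⌋₊ := by
  rw [Fin.card_filter_val_lt, min_eq_right]
  refine Nat.floor_le_of_le ?_
  exact mul_le_of_le_one_right (Nat.cast_nonneg n) hρ1

theorem card_filter_not_lt_floor {n : ℕ} {ρ : ℝ} (hρ1 : ρ ≤ 1) :
    ((Finset.univ.filter fun i : Fin n => ¬ (i : ℕ) < ⌊(n : ℝ) * ρ⌋₊).card : ℝ) =
      n - ⌊(n : ℝ) * ρ⌋₊ := by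
  have h := Finset.card_filter_add_card_filter_not (s := Finset.univ)
    (fun i : Fin n => (i : ℕ) < ⌊(n : ℝ) * ρ⌋₊)
  rw [card_filter_lt_floor hρ1, Finset.card_univ, Fintype.card_fin] at h
  rw [eq_sub_iff_add_eq', ← Nat.cast_add, h]

theorem rpow_le_prod_ite {n : ℕ} {ρ α β : ℝ} (hρ0 : 0 ≤ ρ) (hρ1 : ρ ≤ 1) (hα : 0 ≤ α)
    (hβ : 0 ≤ β) :
    (2 : ℝ) ^ (n * (ρ * α + (1 - ρ) * β) - α) ≤
      ∏ i : Fin n, if (i : ℕ) < ⌊(n : ℝ) * ρ⌋₊ then (2 : ℝ) ^ α else 2 ^ β := by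
  rw [Finset.prod_ite, Finset.prod_const, Finset.prod_const, ← Real.rpow_natCast,
    ← Real.rpow_natCast, ← Real.rpow_mul (by norm_num), ← Real.rpow_mul (by norm_num),
    ← Real.rpow_add (by norm_num), card_filter_lt_floor hρ1, card_filter_not_lt_floor hρ1]
  refine Real.rpow_le_rpow_of_exponent_le (by norm_num) ?_
  -- Rounding shortens the head by less than one coordinate, which costs at most α in the exponent;
  -- the tail only gets longer.
  have h1 := Nat.lt_floor_add_one ((n : ℝ) * ρ)
  have h2 := Nat.floor_le (mul_nonneg (Nat.cast_nonneg n) hρ0)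
  nlinarith

/-- A converse bound for a product source whose coordinates satisfy conditional min-entropy bounds
given the side information `t`. -/
theorem Source.rate_lower_bound (P : Source X Y) {ρ α β : ℝ} (hρ0 : 0 ≤ ρ) (hρ1 : ρ ≤ 1)
    (hα : 0 ≤ α) (hβ : 0 ≤ β) (W : ℕ → ℕ → X → Y → ℝ) (hW0 : ∀ m i x y, 0 ≤ W m i x y)
    (hW : ∀ n x y, P.prob n x y = ∏ i : Fin n, W ⌊(n : ℝ) * ρ⌋₊ i (x i) (y i))
    {T : Type*} [Fintype T] (t : X → Y → T) (u : ℕ → ℕ → T → ℝ) (hu0 : ∀ m i b, 0 ≤ u m i b)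
    (hu : ∀ m i, ∑ b, u m i b = 1)
    (hWu : ∀ m i x y, W m i x y ≤ u m i (t x y) / (if i < m then (2 : ℝ) ^ α else 2 ^ β))
    (Φ : ∀ n, Code (Fin n → X) (Fin n → Y) ((Fin n → X) × (Fin n → Y)))
    (herr : Tendsto (fun n => P.errorProb (fun x y => (x, y)) (Φ n)) atTop (nhds 0))
    (c : ∀ n, (Fin n → X) × (Fin n → Y) → List Bool)
    (hinj : ∀ n ω ω', (∀ i, t (ω.1 i) (ω.2 i) = t (ω'.1 i) (ω'.2 i)) → c n ω = c n ω' →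
      (Φ n).output ω.1 ω.2 = (Φ n).output ω'.1 ω'.2) {R : ℝ}
    (hR : ∀ γ : ℝ, 0 < γ → ∀ᶠ n : ℕ in atTop,
      (∑ ω, P.prob n ω.1 ω.2 * ((c n ω).length : ℝ)) / n < R + γ) :
    ρ * α + (1 - ρ) * β ≤ R := by
  refine le_of_expected_length_bound _ _ _ α R (fun n l => ?_) herr hR
  refine P.le_sum_length (Φ n) (fun ω i => t (ω.1 i) (ω.2 i)) (c n)
    (fun ω ω' h => hinj n ω ω' (congrFun h))
    (fun b => ∏ i : Fin n, u ⌊(n : ℝ) * ρ⌋₊ i (b i)) (fun b => Finset.prod_nonneg fun i _ => hu0 _ _ _)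
    ?_ _ (by positivity) (fun ω => ?_) l
  · rw [sum_prod_apply (fun (i : Fin n) b => u ⌊(n : ℝ) * ρ⌋₊ i b)]
    exact (Finset.prod_eq_one fun i _ => hu _ _).le
  · rw [hW]
    refine (Finset.prod_le_prod (fun i _ => hW0 _ _ _ _) (fun i _ => hWu _ _ _ _)).trans ?_
    rw [Finset.prod_div_distrib]
    exact div_le_div_of_nonneg_left (Finset.prod_nonneg fun i _ => hu0 _ _ _) (by positivity)
      (rpow_le_prod_ite hρ0 hρ1 hα hβ)

variable {p : ℕ} (a : X ↪ ZMod p) (b : Y ↪ ZMod p) {ε : ℝ}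

theorem swRegion_matchedSource_subset [Nonempty X] [Nonempty Y] (hε : 0 < ε) (hε1 : ε ≤ 1)
    {ρ r₀ : ℝ} (hρ0 : 0 ≤ ρ) (hρ1 : ρ ≤ 1)
    (hr₀ : r₀ = min (Real.logb 2 (Fintype.card X)) (Real.logb 2 (Fintype.card Y)))
    (hab : min (Fintype.card X : ℝ) (Fintype.card Y) ≤
      ∑ x, ∑ y, if a x + b y = 0 then (1 : ℝ) else 0)
    (k : CodingKind) {R : ℝ × ℝ} (hR : R ∈ swRegion k (matchedSource a b hε ρ)) :
    (1 - ρ) * Real.logb 2 (Fintype.card X) ≤ R.1 ∧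
      (1 - ρ) * Real.logb 2 (Fintype.card Y) ≤ R.2 ∧
      ρ * r₀ + (1 - ρ) * Real.logb 2 ((Fintype.card X : ℝ) * (Fintype.card Y : ℝ)) ≤
        R.1 + R.2 := by
  obtain ⟨Φ, -, herr, h1, h2⟩ := hR
  have hX : (1 : ℝ) ≤ Fintype.card X := by exact_mod_cast Fintype.card_pos
  have hY : (1 : ℝ) ≤ Fintype.card Y := by exact_mod_cast Fintype.card_pos
  have hX0 := zero_lt_one.trans_le hX
  have hY0 := zero_lt_one.trans_le hY
  have h2X := Real.rpow_logb (by norm_num : (0 : ℝ) < 2) (by norm_num) hX0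
  have h2Y := Real.rpow_logb (by norm_num : (0 : ℝ) < 2) (by norm_num) hY0
  have h2XY := Real.rpow_logb (by norm_num : (0 : ℝ) < 2) (by norm_num) (mul_pos hX0 hY0)
  have hlX := Real.logb_nonneg (by norm_num : (1 : ℝ) < 2) hX
  have hlY := Real.logb_nonneg (by norm_num : (1 : ℝ) < 2) hY
  have hlXY := Real.logb_nonneg (by norm_num : (1 : ℝ) < 2) (one_le_mul_of_one_le_of_one_le hX hY)
  have hW0 := coordDist_nonneg a b hε
  have hE1 := eventually_lt_of_limsup_le h1
  have hE2 := eventually_lt_of_limsup_le h2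
  simp_rw [Source.avgLength₁_eq] at hE1
  simp_rw [Source.avgLength₂_eq] at hE2
  refine ⟨?_, ?_, ?_⟩
  -- Side information y: the head is credited with conditional min-entropy 0, while in the tail x is
  -- uniform given y.
  · have := (matchedSource a b hε ρ).rate_lower_bound hρ0 hρ1 le_rfl hlX
      (coordDist a b ε) hW0 (fun _ _ _ => rfl) (fun _ y => y)
      (fun m i y => ∑ x, coordDist a b ε m i x y)
      (fun m i y => Finset.sum_nonneg fun x _ => hW0 m i x y)
      (fun m i => by rw [Finset.sum_comm]; exact sum_coordDist a b hε m i)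
      (fun m i x y => ?_) Φ herr (fun n ω => (Φ n).enc₁ ω.1)
      (fun n ω ω' h h' => (Φ n).output_congr h' (congrArg _ (funext h))) hE1
    · simpa using this
    · have := Finset.single_le_sum (f := fun x => coordDist a b ε m i x y)
        (fun x _ => hW0 m i x y) (Finset.mem_univ x)
      split_ifs with h
      · simpa using this
      · rw [h2X]
        simp only [coordDist, if_neg h, Finset.sum_const, Finset.card_univ, nsmul_eq_mul]
        exact le_of_eq (by field_simp)
  · have := (matchedSource a b hε ρ).rate_lower_bound hρ0 hρ1 le_rfl hlY
      (coordDist a b ε) hW0 (fun _ _ _ => rfl) (fun x _ => x)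
      (fun m i x => ∑ y, coordDist a b ε m i x y)
      (fun m i x => Finset.sum_nonneg fun y _ => hW0 m i x y)
      (fun m i => sum_coordDist a b hε m i)
      (fun m i x y => ?_) Φ herr (fun n ω => (Φ n).enc₂ ω.2)
      (fun n ω ω' h h' => (Φ n).output_congr (congrArg _ (funext h)) h') hE2
    · simpa using this
    · have := Finset.single_le_sum (f := fun y => coordDist a b ε m i x y)
        (fun y _ => hW0 m i x y) (Finset.mem_univ y)
      split_ifs with h
      · simpa using this
      · rw [h2Y]
        simp only [coordDist, if_neg h, Finset.sum_const, Finset.card_univ, nsmul_eq_mul]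
        exact le_of_eq (by field_simp)
  -- The matched pairs alone make the normalizing constant at least 2^r₀, so no head pair has
  -- probability above 2^(-r₀). This is the head's contribution to the sum rate, with trivial side
  -- information.
  · have hr2 : (2 : ℝ) ^ r₀ ≤ ∑ x, ∑ y, pairWeight a b ε x y := by
      refine le_trans (le_min ?_ ?_) (hab.trans (le_sum_pairWeight a b hε))
      · rw [hr₀, ← h2X, Real.logb_rpow (by norm_num) (by norm_num)]
        exact Real.rpow_le_rpow_of_exponent_le (by norm_num) (min_le_left _ _)
      · rw [hr₀, ← h2Y, Real.logb_rpow (by norm_num) (by norm_num)]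
        exact Real.rpow_le_rpow_of_exponent_le (by norm_num) (min_le_right _ _)
    refine (matchedSource a b hε ρ).rate_lower_bound hρ0 hρ1 (hr₀ ▸ le_min hlX hlY) hlXY
      (coordDist a b ε) hW0 (fun _ _ _ => rfl) (fun _ _ => ()) (fun _ _ _ => 1)
      (fun _ _ _ => zero_le_one) (fun _ _ => by simp) (fun m i x y => ?_) Φ herr
      (fun n ω => (Φ n).enc₁ ω.1 ++ (Φ n).enc₂ ω.2)
      (fun n ω ω' _ h => (Φ n).output_congr ((Φ n).append_inj h).1 ((Φ n).append_inj h).2)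
      (fun γ hγ => ?_)
    · rw [h2XY]
      unfold coordDist
      split_ifs
      · exact div_le_div₀ zero_le_one (pairWeight_le_one a b hε1 x y) (by positivity) hr2
      · exact le_rfl
    · filter_upwards [hE1 (γ / 2) (half_pos hγ), hE2 (γ / 2) (half_pos hγ)] with n hn1 hn2
      simp only [List.length_append, Nat.cast_add, mul_add, Finset.sum_add_distrib, add_div]
      linarith

end Converse

/-! ### Achievability -/

section Achievability

variable {X Y : Type*} [Fintype X] [Fintype Y]

theorem Source.avgLength₁_of_length (P : Source X Y) {n : ℕ} {Z : Type*}
    (Φ : Code (Fin n → X) (Fin n → Y) Z) {l : ℕ} (h : ∀ x, (Φ.enc₁ x).length = l) :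
    P.avgLength₁ Φ = l := by
  simp_rw [P.avgLength₁_eq, h, ← Finset.sum_mul, P.sum_prob, one_mul]

theorem Source.avgLength₂_of_length (P : Source X Y) {n : ℕ} {Z : Type*}
    (Φ : Code (Fin n → X) (Fin n → Y) Z) {l : ℕ} (h : ∀ y, (Φ.enc₂ y).length = l) :
    P.avgLength₂ Φ = l := by
  simp_rw [P.avgLength₂_eq, h, ← Finset.sum_mul, P.sum_prob, one_mul]

theorem Source.errorProb_nonneg (P : Source X Y) {n : ℕ} {Z : Type*}
    (f : (Fin n → X) → (Fin n → Y) → Z) (Φ : Code (Fin n → X) (Fin n → Y) Z) :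
    0 ≤ P.errorProb f Φ := by
  refine Finset.sum_nonneg fun x _ => Finset.sum_nonneg fun y _ => ?_
  split_ifs
  exacts [P.nonneg _ _ _, le_rfl]

theorem limsup_div_le_of_le_mul_add {l : ℕ → ℝ} {R C : ℝ} (h : ∀ n : ℕ, l n ≤ n * R + C) :
    limsup (fun n : ℕ => ((l n / n : ℝ) : EReal)) atTop ≤ (R : EReal) := by
  refine limsup_le_of_tendsto (b := fun n : ℕ => R + C / n) ?_ ?_
  · filter_upwards [eventually_gt_atTop 0] with n hn
    have hn' : (0 : ℝ) < n := by exact_mod_cast hn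
    rw [div_le_iff₀ hn', add_mul, div_mul_cancel₀ _ hn'.ne', mul_comm R]
    exact h n
  · simpa using (tendsto_const_div_atTop_nhds_zero_nat C).const_add R

/-- Fixed-length codes of rate approaching `R` with vanishing error show that `R` is achievable by
either kind of coding. -/
theorem mem_achievableRegion_of_fixedLength (k : CodingKind) (P : Source X Y) {Z : ℕ → Type*}
    (f : ∀ n, (Fin n → X) → (Fin n → Y) → Z n) (R : ℝ × ℝ) (C : ℝ) (e : ℕ → ℝ)
    (he : Tendsto e atTop (nhds 0))
    (h : ∀ n, ∃ (Φ : Code (Fin n → X) (Fin n → Y) (Z n)) (l₁ l₂ : ℕ),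
      (∀ x, (Φ.enc₁ x).length = l₁) ∧ (∀ y, (Φ.enc₂ y).length = l₂) ∧
      (l₁ : ℝ) ≤ n * R.1 + C ∧ (l₂ : ℝ) ≤ n * R.2 + C ∧ P.errorProb (f n) Φ ≤ e n) :
    R ∈ achievableRegion k P f := by
  choose Φ l₁ l₂ h₁ h₂ hR₁ hR₂ herr using h
  refine ⟨Φ, fun n => ?_, squeeze_zero (fun n => P.errorProb_nonneg _ _) herr he, ?_, ?_⟩
  · cases k
    · exact ⟨⟨l₁ n, h₁ n⟩, ⟨l₂ n, h₂ n⟩⟩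
    · trivial
  · simp_rw [fun n => P.avgLength₁_of_length (Φ n) (h₁ n)]
    exact limsup_div_le_of_le_mul_add hR₁
  · simp_rw [fun n => P.avgLength₂_of_length (Φ n) (h₂ n)]
    exact limsup_div_le_of_le_mul_add hR₂

theorem Source.errorProb_eq_zero (P : Source X Y) {n : ℕ} {Z : Type*}
    (f : (Fin n → X) → (Fin n → Y) → Z) (Φ : Code (Fin n → X) (Fin n → Y) Z)
    (h : ∀ x y, Φ.output x y = f x y) : P.errorProb f Φ = 0 := by
  simp [Source.errorProb, h]

theorem clog_card_fun_le (X : Type*) [Fintype X] [Nonempty X] (n : ℕ) :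
    (Nat.clog 2 (Fintype.card (Fin n → X)) : ℝ) ≤ n * Real.logb 2 (Fintype.card X) + 1 := by
  refine (natCast_clog_le _ Fintype.card_pos).trans_eq ?_
  rw [Fintype.card_fun, Fintype.card_fin, Nat.cast_pow, Real.logb_pow]

theorem logb_card_mem_swRegion [Nonempty X] [Nonempty Y] (k : CodingKind) (P : Source X Y) :
    (Real.logb 2 (Fintype.card X), Real.logb 2 (Fintype.card Y)) ∈ swRegion k P := by
  refine mem_achievableRegion_of_fixedLength k P _ _ 1 (fun _ => 0) tendsto_const_nhds fun n => ?_
  obtain ⟨Φ, h₁, h₂, h⟩ := exists_fixedLength_code (id : (Fin n → X) → _) (id : (Fin n → Y) → _)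
    Prod.mk
  exact ⟨Φ, _, _, h₁, h₂, clog_card_fun_le X n, clog_card_fun_le Y n,
    (P.errorProb_eq_zero _ Φ h).le⟩

theorem clog_card_prod_tail_le {Q : Type*} [Fintype Q] [Nonempty Q] (X : Type*) [Fintype X]
    [Nonempty X] {n : ℕ} {ρ κ : ℝ} (hρ1 : ρ ≤ 1)
    (hQ : (Fintype.card Q : ℝ) ≤ 2 ^ (κ * n)) :
    (Nat.clog 2 (Fintype.card
      (Q × ({i : Fin n // ¬ (i : ℕ) < ⌊(n : ℝ) * ρ⌋₊} → X))) : ℝ) ≤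
      n * (κ + (1 - ρ) * Real.logb 2 (Fintype.card X)) + (Real.logb 2 (Fintype.card X) + 1) := by
  have hQ0 : (0 : ℝ) < Fintype.card Q := by exact_mod_cast Fintype.card_pos
  have hX1 : (1 : ℝ) ≤ Fintype.card X := by exact_mod_cast Fintype.card_pos
  have hX0 := zero_lt_one.trans_le hX1
  refine (natCast_clog_le _ Fintype.card_pos).trans ?_
  rw [Fintype.card_prod, Fintype.card_fun, Nat.cast_mul, Nat.cast_pow,
    Real.logb_mul hQ0.ne' (by positivity), Real.logb_pow, Fintype.card_subtype,
    card_filter_not_lt_floor hρ1]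
  have h1 : Real.logb 2 (Fintype.card Q) ≤ κ * n := by
    have := Real.logb_le_logb_of_le (by norm_num : (1 : ℝ) < 2) hQ0 hQ
    rwa [Real.logb_rpow (by norm_num) (by norm_num)] at this
  -- The tail has at most n(1-ρ) + 1 coordinates; the extra one accounts for the additive log|X|.
  have h2 := Nat.lt_floor_add_one ((n : ℝ) * ρ)
  have h3 := Real.logb_nonneg (by norm_num : (1 : ℝ) < 2) hX1
  nlinarith

variable {p : ℕ} (a : X ↪ ZMod p) (b : Y ↪ ZMod p)

/-- The sum `a x + b y` of the embedded sequences, cut off at the first `m` coordinates. -/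
def headSum {n : ℕ} (m : ℕ) (x : Fin n → X) (y : Fin n → Y) (i : Fin n) : ZMod p :=
  (if (i : ℕ) < m then a (x i) else 0) + (if (i : ℕ) < m then b (y i) else 0)

/-- Linear coding of the head (as for the modulo-sum problem) and uncoded transmission of the tail
recover `partialSum` whenever the sum sequence has small weight. -/
theorem exists_code_partialSum [Fact p.Prime] [Nonempty X] [Nonempty Y] {ρ κ τ : ℝ} (hρ1 : ρ ≤ 1)
    (hτ : 0 < τ) (n : ℕ)
    (hball : (Nat.card {v : Fin n → ZMod p // (hammingNorm v : ℝ) ≤ 2 * (τ * n)} : ℝ) ≤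
      2 ^ (κ * n)) :
    ∃ (Φ : Code (Fin n → X) (Fin n → Y) (Fin n → ZMod p ⊕ (X × Y))) (l₁ l₂ : ℕ),
      (∀ x, (Φ.enc₁ x).length = l₁) ∧ (∀ y, (Φ.enc₂ y).length = l₂) ∧
      (l₁ : ℝ) ≤ n * (κ + (1 - ρ) * Real.logb 2 (Fintype.card X)) +
        (Real.logb 2 (Fintype.card X) + 1) ∧
      (l₂ : ℝ) ≤ n * (κ + (1 - ρ) * Real.logb 2 (Fintype.card Y)) +
        (Real.logb 2 (Fintype.card Y) + 1) ∧
      ∀ x y, (hammingNorm (headSum a b ⌊(n : ℝ) * ρ⌋₊ x y) : ℝ) ≤ τ * n →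
        Φ.output x y = partialSum a b ρ n x y := by
  classical
  obtain ⟨V, hV, hcard⟩ := exists_submodule_hammingNorm (F := ZMod p) n (2 * (τ * n))
    (by positivity)
  let _ : Fintype ((Fin n → ZMod p) ⧸ V) := Fintype.ofFinite _
  have hQ : (Fintype.card ((Fin n → ZMod p) ⧸ V) : ℝ) ≤ 2 ^ (κ * n) := by
    rw [← Nat.card_eq_fintype_card]
    exact le_trans (by exact_mod_cast hcard) hball
  let m := ⌊(n : ℝ) * ρ⌋₊
  -- Syndrome decoding: pick a vector of weight at most τn in the coset. It is unique, because the
  -- difference of two such vectors lies in V and has weight at most 2τn.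
  let sel : (Fin n → ZMod p) ⧸ V → Fin n → ZMod p := fun q =>
    if h : ∃ z : Fin n → ZMod p, V.mkQ z = q ∧ (hammingNorm z : ℝ) ≤ τ * n then h.choose else 0
  have hsel : ∀ z : Fin n → ZMod p, (hammingNorm z : ℝ) ≤ τ * n → sel (V.mkQ z) = z := by
    intro z hz
    have h : ∃ z' : Fin n → ZMod p, V.mkQ z' = V.mkQ z ∧ (hammingNorm z' : ℝ) ≤ τ * n :=
      ⟨z, rfl, hz⟩
    simp only [sel, dif_pos h]
    refine sub_eq_zero.1 (hV _ ((Submodule.Quotient.eq V).1 h.choose_spec.1) ?_)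
    rw [sub_eq_neg_add, ← hammingDist_eq_hammingNorm, hammingDist_comm]
    have h1 := hammingDist_triangle h.choose 0 z
    rw [hammingDist_zero_right, hammingDist_zero_left] at h1
    have h2 : (hammingDist h.choose z : ℝ) ≤ hammingNorm h.choose + hammingNorm z := by
      exact_mod_cast h1
    linarith [h.choose_spec.2]
  obtain ⟨Φ, h₁, h₂, hΦ⟩ := exists_fixedLength_code
    (fun x : Fin n → X => (V.mkQ (fun i => if (i : ℕ) < m then a (x i) else 0),
      fun i : {i : Fin n // ¬ (i : ℕ) < m} => x i))
    (fun y : Fin n → Y => (V.mkQ (fun i => if (i : ℕ) < m then b (y i) else 0),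
      fun i : {i : Fin n // ¬ (i : ℕ) < m} => y i))
    (fun s t (i : Fin n) => if h : (i : ℕ) < m then (Sum.inl (sel (s.1 + t.1) i) :
      ZMod p ⊕ (X × Y)) else Sum.inr (s.2 ⟨i, h⟩, t.2 ⟨i, h⟩))
  refine ⟨Φ, _, _, h₁, h₂, clog_card_prod_tail_le X hρ1 hQ, clog_card_prod_tail_le Y hρ1 hQ,
    fun x y hxy => ?_⟩
  rw [hΦ]
  funext i
  have hs := hsel _ hxy
  unfold partialSum
  by_cases hi : (i : ℕ) < m
  · rw [dif_pos hi, if_pos hi]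
    dsimp only
    -- By linearity the two syndromes add up to the syndrome of the head sum.
    rw [← map_add]
    refine congrArg Sum.inl ((congrFun hs i).trans ?_)
    unfold headSum
    rw [if_pos hi, if_pos hi]
  · rw [dif_neg hi, if_neg hi]

/-- This is one factor of the expectation of 2^weight. Replacing 1 by 2 adds the probability of an
unmatched head pair, at most ε as the normalizing constant is at least 1; in the tail the cut-off
sum is zero. -/
theorem sum_coordDist_mul_le [Nonempty X] [Nonempty Y] {ε : ℝ} (hε : 0 < ε)
    (hT : 1 ≤ ∑ x, ∑ y, pairWeight a b ε x y) (m i : ℕ) :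
    ∑ x, ∑ y, coordDist a b ε m i x y *
        (if (if i < m then a x else 0) + (if i < m then b y else 0) ≠ 0 then 2 else 1) ≤
      1 + ε * (Fintype.card X * Fintype.card Y) := by
  have hbound : ∀ x y, coordDist a b ε m i x y *
      (if (if i < m then a x else 0) + (if i < m then b y else 0) ≠ 0 then 2 else 1) ≤
      coordDist a b ε m i x y + ε := by
    intro x y
    split_ifs with h1 h2 h2
    · have : coordDist a b ε m i x y ≤ ε := by
        rw [coordDist, if_pos h1, pairWeight, if_neg h2]
        exact div_le_self hε.le hT
      linarith
    · linarith
    · simp at h2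
    · linarith
  refine (Finset.sum_le_sum fun x _ => Finset.sum_le_sum fun y _ => hbound x y).trans_eq ?_
  simp_rw [Finset.sum_add_distrib, sum_coordDist a b hε]
  simp only [Finset.sum_const, Finset.card_univ, nsmul_eq_mul]
  ring

/-- Exponential Markov bound for the weight of the sum sequence. -/
theorem errorProb_matchedSource_le [Nonempty X] [Nonempty Y] {ε ρ τ : ℝ} (hε : 0 < ε)
    (hT : 1 ≤ ∑ x, ∑ y, pairWeight a b ε x y) {n : ℕ} {Z : Type*}
    (f : (Fin n → X) → (Fin n → Y) → Z) (Φ : Code (Fin n → X) (Fin n → Y) Z)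
    (h : ∀ x y, (hammingNorm (headSum a b ⌊(n : ℝ) * ρ⌋₊ x y) : ℝ) ≤ τ * n →
      Φ.output x y = f x y) :
    (matchedSource a b hε ρ).errorProb f Φ ≤
      ((1 + ε * (Fintype.card X * Fintype.card Y)) / 2 ^ τ) ^ n := by
  have hprod : ∀ z : Fin n → ZMod p, (2 : ℝ) ^ hammingNorm z = ∏ i, if z i ≠ 0 then 2 else 1 := by
    intro z
    rw [Finset.prod_ite]
    simp [hammingNorm]
  rw [div_pow, ← Real.rpow_natCast (2 ^ τ), ← Real.rpow_mul (by norm_num),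
    le_div_iff₀ (by positivity)]
  unfold Source.errorProb
  calc _ ≤ ∑ x : Fin n → X, ∑ y : Fin n → Y, (matchedSource a b hε ρ).prob n x y *
        2 ^ hammingNorm (headSum a b ⌊(n : ℝ) * ρ⌋₊ x y) := by
        simp_rw [Finset.sum_mul]
        refine Finset.sum_le_sum fun x _ => Finset.sum_le_sum fun y _ => ?_
        have h0 := (matchedSource a b hε ρ).nonneg n x y
        split_ifs with hxy
        · refine mul_le_mul_of_nonneg_left ?_ h0
          rw [← Real.rpow_natCast]
          refine Real.rpow_le_rpow_of_exponent_le (by norm_num) ?_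
          by_contra! hlt
          exact hxy (h x y hlt.le).symm
        · rw [zero_mul]
          positivity
    _ = ∏ i : Fin n, ∑ x, ∑ y, coordDist a b ε ⌊(n : ℝ) * ρ⌋₊ i x y *
        (if (if (i : ℕ) < ⌊(n : ℝ) * ρ⌋₊ then a x else 0) +
          (if (i : ℕ) < ⌊(n : ℝ) * ρ⌋₊ then b y else 0) ≠ 0 then 2 else 1) := by
        rw [← sum_sum_prod_apply (fun (i : Fin n) x y => coordDist a b ε ⌊(n : ℝ) * ρ⌋₊ i x y *
          (if (if (i : ℕ) < ⌊(n : ℝ) * ρ⌋₊ then a x else 0) +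
          (if (i : ℕ) < ⌊(n : ℝ) * ρ⌋₊ then b y else 0) ≠ 0 then (2 : ℝ) else 1))]
        refine Finset.sum_congr rfl fun x _ => Finset.sum_congr rfl fun y _ => ?_
        rw [hprod, Finset.prod_mul_distrib]
        rfl
    _ ≤ ∏ i : Fin n, (1 + ε * (Fintype.card X * Fintype.card Y)) := by
        refine Finset.prod_le_prod (fun i _ => ?_) fun i _ => sum_coordDist_mul_le a b hε hT _ _
        refine Finset.sum_nonneg fun x _ => Finset.sum_nonneg fun y _ =>
          mul_nonneg (coordDist_nonneg a b hε _ _ _ _) ?_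
        split_ifs <;> norm_num
    _ = _ := by simp

theorem mem_achievableRegion_partialSum [Fact p.Prime] [Nonempty X] [Nonempty Y] {ε ρ κ τ : ℝ}
    (hε : 0 < ε) (hT : 1 ≤ ∑ x, ∑ y, pairWeight a b ε x y) (hρ1 : ρ ≤ 1) (hτ : 0 < τ)
    (hετ : 1 + ε * (Fintype.card X * Fintype.card Y) < 2 ^ τ)
    (hball : ∀ n : ℕ, (Nat.card {v : Fin n → ZMod p // (hammingNorm v : ℝ) ≤ 2 * (τ * n)} : ℝ) ≤
      2 ^ (κ * n)) (k : CodingKind) {R : ℝ × ℝ}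
    (hR₁ : κ + (1 - ρ) * Real.logb 2 (Fintype.card X) ≤ R.1)
    (hR₂ : κ + (1 - ρ) * Real.logb 2 (Fintype.card Y) ≤ R.2) :
    R ∈ achievableRegion k (matchedSource a b hε ρ) (partialSum a b ρ) := by
  refine mem_achievableRegion_of_fixedLength k _ _ R
    (max (Real.logb 2 (Fintype.card X) + 1) (Real.logb 2 (Fintype.card Y) + 1)) _
    (tendsto_pow_atTop_nhds_zero_of_lt_one (by positivity)
      ((div_lt_one (by positivity)).2 hετ)) fun n => ?_
  obtain ⟨Φ, l₁, l₂, h₁, h₂, hl₁, hl₂, h⟩ := exists_code_partialSum a b hρ1 hτ n (hball n)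
  exact ⟨Φ, l₁, l₂, h₁, h₂,
    hl₁.trans (add_le_add (mul_le_mul_of_nonneg_left hR₁ n.cast_nonneg) (le_max_left _ _)),
    hl₂.trans (add_le_add (mul_le_mul_of_nonneg_left hR₂ n.cast_nonneg) (le_max_right _ _)),
    errorProb_matchedSource_le a b hε hT _ Φ h⟩

end Achievability

/-! ### Total sensitivity -/

section Sensitivity

variable {X Y : Type*} {p : ℕ} (a : X ↪ ZMod p) (b : Y ↪ ZMod p)

/-- With the other argument fixed, distinct sequences never give equal values, so the premise of
sensitivity cannot occur. -/
theorem partialSum_left_injective (ρ : ℝ) {n : ℕ} {x x' : Fin n → X} {y : Fin n → Y}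
    (h : partialSum a b ρ n x y = partialSum a b ρ n x' y) : x = x' := by
  funext i
  have hi := congrFun h i
  unfold partialSum at hi
  split_ifs at hi
  · exact a.injective (add_right_cancel (Sum.inl.inj hi))
  · exact congrArg Prod.fst (Sum.inr.inj hi)

theorem partialSum_right_injective (ρ : ℝ) {n : ℕ} {x : Fin n → X} {y y' : Fin n → Y}
    (h : partialSum a b ρ n x y = partialSum a b ρ n x y') : y = y' := by
  funext i
  have hi := congrFun h i
  unfold partialSum at hi
  split_ifs at hi
  · exact b.injective (add_left_cancel (Sum.inl.inj hi))
  · exact congrArg Prod.snd (Sum.inr.inj hi)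

theorem card_le_pow_of_injective_of_tail_eq {A : Type*} [Fintype A] {n m J : ℕ}
    (x : Fin J → Fin n → A) (hx : Function.Injective x)
    (htail : ∀ j j' i, ¬ (i : Fin n).val < m → x j i = x j' i) :
    J ≤ Fintype.card A ^ (Finset.univ.filter fun i : Fin n => (i : ℕ) < m).card := by
  classical
  have hinj : Function.Injective
      (fun (j : Fin J) (i : {i : Fin n // (i : ℕ) < m}) => x j i) := by
    intro j j' h
    refine hx (funext fun i => ?_)
    by_cases hi : (i : ℕ) < m
    · exact congrFun h ⟨i, hi⟩
    · exact htail j j' i hi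
  have := Fintype.card_le_of_injective _ hinj
  rwa [Fintype.card_fin, Fintype.card_fun, Fintype.card_subtype] at this

/-- A common value z fixes the tails of all the pairs, so distinct sequences must already differ in
the head; this is counted in both alphabets. -/
theorem eqNumber_partialSum_le [Fintype X] [Fintype Y] {ρ : ℝ} (hρ1 : ρ ≤ 1) (n : ℕ)
    (z : Fin n → ZMod p ⊕ (X × Y)) :
    eqNumber (partialSum a b ρ n) z ≤
      min (Fintype.card X) (Fintype.card Y) ^ ⌊(n : ℝ) * ρ⌋₊ := by
  refine csSup_le' ?_
  rintro J ⟨x, y, hx, hy, hz⟩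
  have htail : ∀ j j' (i : Fin n), ¬ (i : ℕ) < ⌊(n : ℝ) * ρ⌋₊ → (x j i, y j i) = (x j' i, y j' i) := by
    intro j j' i hi
    have h := congrFun ((hz j).trans (hz j').symm) i
    unfold partialSum at h
    rw [if_neg hi, if_neg hi] at h
    exact Sum.inr.inj h
  have h1 := card_le_pow_of_injective_of_tail_eq x hx
    (fun j j' i hi => congrArg Prod.fst (htail j j' i hi))
  have h2 := card_le_pow_of_injective_of_tail_eq y hy
    (fun j j' i hi => congrArg Prod.snd (htail j j' i hi))
  rw [card_filter_lt_floor hρ1] at h1 h2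
  rcases min_choice (Fintype.card X) (Fintype.card Y) with h | h <;> rw [h] <;> assumption

theorem rTotallySensitive_partialSum [Fintype X] [Fintype Y] [Nonempty X] [Nonempty Y]
    {r r₀ ρ : ℝ} (hρ0 : 0 ≤ ρ) (hρ1 : ρ ≤ 1)
    (hr₀ : r₀ = min (Real.logb 2 (Fintype.card X)) (Real.logb 2 (Fintype.card Y)))
    (hr : r = ρ * r₀) : RTotallySensitive r (partialSum a b ρ) := by
  refine ⟨limsup_le_of_tendsto (Eventually.of_forall fun n => ?_) tendsto_const_nhds,
    fun n x x' y i h hi => (hi (congrFun (partialSum_left_injective a b ρ h) i)).elim,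
    fun n y y' x i h hi => (hi (congrFun (partialSum_right_injective a b ρ h) i)).elim⟩
  have hX : 1 ≤ Fintype.card X := Fintype.card_pos
  have hY : 1 ≤ Fintype.card Y := Fintype.card_pos
  have hmin : Real.logb 2 ((min (Fintype.card X) (Fintype.card Y) : ℕ) : ℝ) = r₀ := by
    rw [hr₀]
    have hmono : ∀ s t : ℕ, 1 ≤ s → s ≤ t → Real.logb 2 s ≤ Real.logb 2 t := fun s t hs h =>
      Real.logb_le_logb_of_le (by norm_num) (by exact_mod_cast hs) (by exact_mod_cast h)
    rcases le_total (Fintype.card X) (Fintype.card Y) with h | h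
    · rw [min_eq_left h, min_eq_left (hmono _ _ hX h)]
    · rw [min_eq_right h, min_eq_right (hmono _ _ hY h)]
  have hr0 : 0 ≤ r₀ := by
    rw [← hmin]
    exact Real.logb_nonneg (by norm_num) (by exact_mod_cast le_min hX hY)
  have hle : (⨆ z, eqNumber (partialSum a b ρ n) z) ≤
      min (Fintype.card X) (Fintype.card Y) ^ ⌊(n : ℝ) * ρ⌋₊ :=
    ciSup_le' fun z => eqNumber_partialSum_le a b hρ1 n z
  have hlog : Real.logb 2 ((⨆ z, eqNumber (partialSum a b ρ n) z : ℕ) : ℝ) ≤ n * r := by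
    -- In the zero case the logarithm takes its default value 0.
    rcases Nat.eq_zero_or_pos (⨆ z, eqNumber (partialSum a b ρ n) z) with h | h
    · rw [h, Nat.cast_zero, Real.logb_zero, hr]
      positivity
    · have := Real.logb_le_logb_of_le (by norm_num : (1 : ℝ) < 2) (by exact_mod_cast h)
        (Nat.cast_le (α := ℝ).2 hle)
      rw [Nat.cast_pow, Real.logb_pow, hmin] at this
      have h2 := Nat.floor_le (mul_nonneg (Nat.cast_nonneg n) hρ0)
      rw [hr]
      nlinarith
  -- At n = 0 the quotient is 0 by convention.
  rcases Nat.eq_zero_or_pos n with rfl | hn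
  · simp only [CharP.cast_eq_zero, div_zero, hr]
    positivity
  · rw [div_le_iff₀ (by exact_mod_cast hn), mul_comm]
    exact hlog

end Sensitivity

end DistComp

/-! ### Choice of parameters and conclusion -/

open DistComp
theorem mainTheorem8 {X Y : Type*} [Fintype X] [Fintype Y] [DecidableEq X] [DecidableEq Y]
    [Nontrivial X] [Nontrivial Y] (δ r rbar ρ : ℝ) (hδ : 0 < δ)
    (hrbar : rbar = min (Real.logb 2 (Fintype.card X)) (Real.logb 2 (Fintype.card Y)))
    (hr₀ : 0 ≤ r) (hr₁ : r ≤ rbar) (hρ : ρ = r / rbar) :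
    ∃ (p : ℕ) (_ : p.Prime) (a : X ↪ ZMod p) (b : Y ↪ ZMod p) (P : Source X Y),
      RTotallySensitive r (partialSum a b ρ) ∧ P.Smooth ∧
      ∀ k : CodingKind,
        {R : ℝ × ℝ | δ + (1 - ρ) * Real.logb 2 (Fintype.card X) ≤ R.1 ∧
            δ + (1 - ρ) * Real.logb 2 (Fintype.card Y) ≤ R.2} ⊆
          achievableRegion k P (partialSum a b ρ) ∧
        swRegion k P ⊆
          {R : ℝ × ℝ | (1 - ρ) * Real.logb 2 (Fintype.card X) ≤ R.1 ∧
            (1 - ρ) * Real.logb 2 (Fintype.card Y) ≤ R.2 ∧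
            r - δ + (1 - ρ) * Real.logb 2 ((Fintype.card X : ℝ) * (Fintype.card Y : ℝ))
              ≤ R.1 + R.2} ∧
        (∀ R ∈ outerBound k P r, (R.1 + δ, R.2 + δ) ∈ achievableRegion k P (partialSum a b ρ)) := by
  have hX : (1 : ℝ) < Fintype.card X := by exact_mod_cast Fintype.one_lt_card
  have hY : (1 : ℝ) < Fintype.card Y := by exact_mod_cast Fintype.one_lt_card
  have hrpos : 0 < rbar := by
    rw [hrbar]
    exact lt_min (Real.logb_pos (by norm_num) hX) (Real.logb_pos (by norm_num) hY)
  have hρ0 : 0 ≤ ρ := hρ ▸ div_nonneg hr₀ hrpos.le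
  have hρ1 : ρ ≤ 1 := hρ ▸ (div_le_one hrpos).2 hr₁
  have hr : r = ρ * rbar := by rw [hρ, div_mul_cancel₀ _ hrpos.ne']
  obtain ⟨p, hp, a, b, hab⟩ := exists_matching_embeddings X Y
  have : Fact p.Prime := ⟨hp⟩
  -- The order of choice is p from the alphabets, τ from δ and p, and then ε from τ. The bound on ε
  -- makes the error base (1 + ε|X||Y|)/2^τ less than 1.
  obtain ⟨τ, hτ, hball⟩ := exists_card_hammingBall_le (ZMod p) δ hδ
  have hτ1 : (0 : ℝ) < 2 ^ τ - 1 := by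
    linarith [Real.one_lt_rpow (by norm_num : (1 : ℝ) < 2) hτ]
  have hXY : (0 : ℝ) < Fintype.card X * Fintype.card Y := by positivity
  obtain ⟨ε, hε, hεlt⟩ : ∃ ε : ℝ, 0 < ε ∧
      ε < min 1 (((2 : ℝ) ^ τ - 1) / (Fintype.card X * Fintype.card Y)) :=
    exists_between (lt_min one_pos (div_pos hτ1 hXY))
  have hε1 : ε < 1 := hεlt.trans_le (min_le_left _ _)
  have hετ : 1 + ε * (Fintype.card X * Fintype.card Y) < 2 ^ τ := by
    have := hεlt.trans_le (min_le_right _ _)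
    rw [lt_div_iff₀ hXY] at this
    linarith
  have hT : 1 ≤ ∑ x, ∑ y, pairWeight a b ε x y :=
    (le_min hX.le hY.le).trans (hab.trans (le_sum_pairWeight a b hε))
  have hsw := fun k R hR => swRegion_matchedSource_subset a b hε hε1.le hρ0 hρ1 hrbar hab k
    (R := R) hR
  refine ⟨p, hp, a, b, matchedSource a b hε ρ, rTotallySensitive_partialSum a b hρ0 hρ1 hrbar hr,
    smooth_matchedSource a b hε hε1 ρ, fun k => ⟨fun R hR =>
      mem_achievableRegion_partialSum a b hε hT hρ1 hτ hετ hball k hR.1 hR.2, fun R hR => ?_,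
      fun R hR => ?_⟩⟩
  · obtain ⟨h1, h2, h3⟩ := hsw k R hR
    exact ⟨h1, h2, by rw [hr]; linarith⟩
  · obtain ⟨-, h1, h2⟩ := hR
    -- Uncoded transmission shows that the sets defining the Slepian-Wolf rates are nonempty, so
    -- their infima inherit the converse bounds instead of being the default 0.
    have hmem := logb_card_mem_swRegion k (matchedSource a b hε ρ)
    have g1 : (1 - ρ) * Real.logb 2 (Fintype.card X) ≤ swRate₁ k (matchedSource a b hε ρ) :=
      le_csInf ⟨_, hmem⟩ fun R₁ h => (hsw k _ h).1
    have g2 : (1 - ρ) * Real.logb 2 (Fintype.card Y) ≤ swRate₂ k (matchedSource a b hε ρ) :=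
      le_csInf ⟨_, hmem⟩ fun R₂ h => (hsw k _ h).2.1
    exact mem_achievableRegion_partialSum a b hε hT hρ1 hτ hετ hball k
      (by dsimp only; linarith) (by dsimp only; linarith)
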